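/- For $s\ge 0$ let $H^s(\mathbb R^n)$ be the usual inhomogeneous Sobolev space of complex-valued functions, with norm $\|u\|_{H^s(\mathbb R^n)}=\|(1-\Delta)^{s/2}u\|_{L^2(\mathbb R^n)}$, and let $H^s_{rad}(\mathbb R^n)$ be the set of radially symmetric $u\in H^s(\mathbb R^n)$. For every integer $n\ge 2$ and every real $s>1/2$ there exists a constant $C=C(s,n)>0$ such that, for every $u\in H^s_{rad}(\mathbb R^n)$, $$\big\||x|^{\frac{n-1}{2}}u\big\|_{L^\infty(\mathbb R^n)}\le C\,\|u\|_{H^s(\mathbb R^n)}$$ and $$\big\||x|^{\frac{n-1}{2}}u\big\|_{L^\infty(\mathbb R^n)}\le C\,\|u\|_{H^{1/2}(\mathbb R^n)}\sqrt{\ln\Big(2+\frac{\|u\|_{H^s(\mathbb R^n)}}{\|u\|_{H^{1/2}(\mathbb R^n)}}\Big)},$$ where for $u=0$ the right-hand side of the second inequality is read as $0$. -/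

import Mathlib

open MeasureTheory TemperedDistribution FourierTransform
open scoped ENNReal SchwartzMap

namespace BrezisGallouetStrauss

/-- The Fourier side of `(1 - Δ)^(s/2) u` for `u ∈ L²(ℝⁿ; ℂ)`. In the convention
`𝓕 u ξ = ∫ exp(-2πi⟪x, ξ⟫) u x dx` used here, `-Δ` has the symbol `(2π‖ξ‖)²`. -/
noncomputable def besselFourier {n : ℕ} (s : ℝ)
    (u : Lp ℂ 2 (volume : Measure (EuclideanSpace ℝ (Fin n)))) :
    EuclideanSpace ℝ (Fin n) → ℂ :=
  fun ξ ↦ (((1 + (2 * Real.pi * ‖ξ‖) ^ 2) ^ (s / 2) : ℝ) : ℂ) *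
    (𝓕 u : Lp ℂ 2 (volume : Measure (EuclideanSpace ℝ (Fin n)))) ξ

/-- The norm `‖u‖_{H^s} = ‖(1 - Δ)^(s/2) u‖_{L²}`, computed by Plancherel on the Fourier side. It is
used for `u ∈ H^s` only, where it is finite before `ENNReal.toReal` is applied. -/
noncomputable def sobolevNorm {n : ℕ} (s : ℝ)
    (u : Lp ℂ 2 (volume : Measure (EuclideanSpace ℝ (Fin n)))) : ℝ :=
  (eLpNorm (besselFourier s u) 2 volume).toReal

/-- `u` is radially symmetric: it agrees almost everywhere with a function of `‖x‖`. -/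
def IsRadial {n : ℕ} (u : Lp ℂ 2 (volume : Measure (EuclideanSpace ℝ (Fin n)))) : Prop :=
  ∃ v : ℝ → ℂ, ∀ᵐ x : EuclideanSpace ℝ (Fin n), u x = v ‖x‖

/-- `u ∈ H^s_rad(ℝⁿ)` (for `s ≥ 0`, so that `H^s ⊆ L²`). -/
def MemSobolevRad {n : ℕ} (s : ℝ)
    (u : Lp ℂ 2 (volume : Measure (EuclideanSpace ℝ (Fin n)))) : Prop :=
  MemSobolev s 2 (u : 𝓢'(EuclideanSpace ℝ (Fin n), ℂ)) ∧ IsRadial u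

/-- For `s ≥ 0`, an `L²` function lies in `H^s` exactly when its `H^s` norm is finite. -/
theorem memSobolev_iff_memLp_besselFourier {n : ℕ} {s : ℝ} (hs : 0 ≤ s)
    (u : Lp ℂ 2 (volume : Measure (EuclideanSpace ℝ (Fin n)))) :
    MemSobolev s 2 (u : 𝓢'(EuclideanSpace ℝ (Fin n), ℂ)) ↔
      MemLp (besselFourier s u) 2 volume := by
  set E := EuclideanSpace ℝ (Fin n)
  set w : ℝ → E → ℂ := fun t x ↦ (((1 + ‖x‖ ^ 2) ^ (t / 2) : ℝ) : ℂ) with hw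
  have hwt : ∀ t, (w t).HasTemperateGrowth := fun t ↦ by
    simp only [hw]; fun_prop
  have hinv : w (-s) * w s = fun _ ↦ 1 := by
    ext x
    simp only [hw, Pi.mul_apply]
    norm_cast
    rw [← Real.rpow_add (by positivity)]
    simp [← add_div]
  have hinv' : w s * w (-s) = fun _ ↦ 1 := by rw [mul_comm, hinv]
  have hmem : MemLp (w (-s)) ∞ (volume : Measure E) := by
    refine memLp_top_of_bound (hwt _).1.continuous.aestronglyMeasurable 1 (.of_forall fun x ↦ ?_)
    simp only [hw]
    rw [Complex.norm_real, Real.norm_eq_abs, abs_of_nonneg (by positivity)]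
    exact Real.rpow_le_one_of_one_le_of_nonpos (by linarith [sq_nonneg ‖x‖]) (by linarith)
  have key : MemSobolev s 2 (u : 𝓢'(E, ℂ)) ↔ MemLp (fun ξ ↦ w s ξ * (𝓕 u : Lp ℂ 2 _) ξ) 2
      (volume : Measure E) := by
    rw [memSobolev_iff_exists_smulLeftCLM_fourier, Lp.fourier_toTemperedDistribution_eq]
    change (∃ f' : Lp ℂ 2 (volume : Measure E), smulLeftCLM ℂ (w s) _ = (f' : 𝓢'(E, ℂ))) ↔ _
    constructor
    · rintro ⟨f', hf'⟩
      have h1 : ((hmem.toLp _ • f' : Lp ℂ 2 (volume : Measure E)) : 𝓢'(E, ℂ)) =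
          ((𝓕 u : Lp ℂ 2 (volume : Measure E)) : 𝓢'(E, ℂ)) := by
        rw [Lp.toTemperedDistribution_smul_eq (hwt _), ← hf',
          smulLeftCLM_smulLeftCLM_apply (hwt s) (hwt (-s))]
        simp [hinv']
      have h2 : (hmem.toLp _ • f' : Lp ℂ 2 (volume : Measure E)) = 𝓕 u := by
        have := LinearMap.ker_eq_bot.mp
          (Lp.ker_toTemperedDistributionCLM_eq_bot (F := ℂ) (μ := (volume : Measure E)) (p := 2))
        exact this h1
      refine (Lp.memLp f').ae_eq ?_
      rw [← h2]
      filter_upwards [Lp.coeFn_lpSMul (r := 2) (hmem.toLp _) f', hmem.coeFn_toLp] with x hx hx'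
      rw [hx, Pi.smul_apply', hx', smul_eq_mul, ← mul_assoc, ← Pi.mul_apply, hinv', one_mul]
    · intro h
      refine ⟨h.toLp _, ?_⟩
      have h2 : (hmem.toLp _ • h.toLp _ : Lp ℂ 2 (volume : Measure E)) = 𝓕 u := by
        refine Lp.ext ?_
        filter_upwards [Lp.coeFn_lpSMul (r := 2) (hmem.toLp _) (h.toLp _), hmem.coeFn_toLp,
          h.coeFn_toLp] with x hx hx' hx''
        rw [hx, Pi.smul_apply', hx', hx'', smul_eq_mul, ← mul_assoc, ← Pi.mul_apply, hinv, one_mul]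
      have h3 := congrArg (fun f : Lp ℂ 2 (volume : Measure E) ↦
        smulLeftCLM ℂ (w s) (f : 𝓢'(E, ℂ))) h2
      rw [← h3, Lp.toTemperedDistribution_smul_eq (hwt _),
        smulLeftCLM_smulLeftCLM_apply (hwt (-s)) (hwt s)]
      simp [hinv]
  rw [key]
  have hF : AEStronglyMeasurable (𝓕 u : Lp ℂ 2 (volume : Measure E)) volume :=
    Lp.aestronglyMeasurable _
  have hb : Continuous fun ξ : E ↦ (((1 + (2 * Real.pi * ‖ξ‖) ^ 2) ^ (s / 2) : ℝ) : ℂ) := by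
    refine Complex.continuous_ofReal.comp (Continuous.rpow_const (by fun_prop) fun x ↦ Or.inl ?_)
    positivity
  have hpi : 1 ≤ 2 * Real.pi := by linarith [Real.pi_gt_three]
  constructor <;> intro h
  · refine h.of_le_mul (c := ((2 * Real.pi) ^ 2) ^ (s / 2))
      (hb.aestronglyMeasurable.mul hF) (.of_forall fun x ↦ ?_)
    simp only [besselFourier, hw, norm_mul, Complex.norm_real, Real.norm_eq_abs]
    rw [abs_of_nonneg (by positivity), abs_of_nonneg (by positivity), ← mul_assoc,
      ← Real.mul_rpow (by positivity) (by positivity)]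
    gcongr
    nlinarith [sq_nonneg ‖x‖]
  · refine h.mono ((hwt s).1.continuous.aestronglyMeasurable.mul hF) (.of_forall fun x ↦ ?_)
    simp only [besselFourier, hw, norm_mul, Complex.norm_real, Real.norm_eq_abs]
    rw [abs_of_nonneg (by positivity), abs_of_nonneg (by positivity)]
    gcongr
    nlinarith [norm_nonneg x]

end BrezisGallouetStrauss

/-! Cut `𝓕 u` sharply into dyadic shells; each piece `u_k` is radial with frequencies of size at
most `2 ^ (k + 1)`. For radial `f`, integrating the derivative of `|f|²` outward from `|x|` gives
`|x|^(n-1) |f(x)|² ≲ ‖f‖ ‖∂_r f‖` in `L²` norms. For a band-limited piece Plancherel bounds the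
derivative by `2 ^ k ‖u_k‖`, so `|x|^((n-1)/2) |u_k(x)| ≲ b_k` with `b_k = 2^(k/2) ‖u_k‖`
(`exists_norm_rpow_mul_norm_fourierInv_le`).

Write `A` and `B` for the `H^(1/2)` and `H^s` norms. Then `∑ b_k² ≤ 2A²` and `b_k ≲ B 2^((1/2-s)k)`.
Cauchy–Schwarz on about `log (B/A)` terms and a geometric series for the rest bound `∑ b_k` by `A
√log (2 + B/A)` (`exists_sum_range_le_mul_sqrt_log`). The first inequality follows from the second
because `A ≤ B`. -/

namespace BrezisGallouetStrauss

/-! ### The `L²` Fourier transform: integral formulas and invariance under isometries. -/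

section Fourier

variable {E : Type*} [NormedAddCommGroup E] [InnerProductSpace ℝ E] [FiniteDimensional ℝ E]
  [MeasurableSpace E] [BorelSpace E]

/-- The Fourier integral of an integrable function is continuous. -/
theorem continuous_fourier_of_integrable {g : E → ℂ} (hg : Integrable g) : Continuous (𝓕 g) :=
  VectorFourier.fourierIntegral_continuous Real.continuous_fourierChar
    (L := innerₗ E) continuous_inner hg

theorem continuous_fourierInv_of_integrable {g : E → ℂ} (hg : Integrable g) :
    Continuous (𝓕⁻ g) := by
  have h : 𝓕⁻ g = fun x ↦ 𝓕 g (-x) := funext (Real.fourierInv_eq_fourier_neg g)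
  rw [h]
  exact (continuous_fourier_of_integrable hg).comp continuous_neg

/-- An `L²` function that represents the same tempered distribution as a continuous function
agrees with it almost everywhere. -/
theorem ae_eq_of_forall_schwartz {f : Lp ℂ 2 (volume : Measure E)} {h : E → ℂ} (hh : Continuous h)
    (H : ∀ φ : 𝓢(E, ℂ), ∫ x, φ x • f x = ∫ x, φ x • h x) : f =ᵐ[volume] h := by
  refine ae_eq_of_integral_contDiff_smul_eq ((Lp.memLp f).locallyIntegrable one_le_two)
    hh.locallyIntegrable fun φ hφ hφc ↦ ?_
  have h1 : HasCompactSupport (Complex.ofRealCLM ∘ φ) := hφc.comp_left rfl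
  have h2 : ContDiff ℝ (⊤ : ℕ∞) (Complex.ofRealCLM ∘ φ) :=
    Complex.ofRealCLM.contDiff.comp hφ
  simpa using H (h1.toSchwartzMap h2)

/-- On `L¹ ∩ L²` the `L²` Fourier transform is given by the Fourier integral. -/
theorem fourier_toLp_ae_eq {g : E → ℂ} (h1 : Integrable g) (h2 : MemLp g 2) :
    (𝓕 (h2.toLp g) : Lp ℂ 2 (volume : Measure E)) =ᵐ[volume] 𝓕 g := by
  refine ae_eq_of_forall_schwartz (continuous_fourier_of_integrable h1) fun φ ↦ ?_
  have e1 := congrArg (fun T : 𝓢'(E, ℂ) ↦ T φ) (Lp.fourier_toTemperedDistribution_eq (h2.toLp g))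
  simp only [TemperedDistribution.fourier_apply, Lp.toTemperedDistribution_apply] at e1
  rw [← e1]
  -- The multiplication formula moves the transform from the test function to `g`.
  have e2 := VectorFourier.integral_fourierIntegral_smul_eq_flip (L := innerₗ E)
    (μ := volume) (ν := volume) Real.continuous_fourierChar continuous_inner φ.integrable h1
  rw [flip_innerₗ] at e2
  refine (integral_congr_ae ?_).trans e2
  filter_upwards [h2.coeFn_toLp] with x hx
  rw [hx]
  rfl

/-- On `L¹ ∩ L²` the inverse `L²` Fourier transform is given by the inverse Fourier integral. -/
theorem fourierInv_toLp_ae_eq {g : E → ℂ} (h1 : Integrable g) (h2 : MemLp g 2) :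
    (𝓕⁻ (h2.toLp g) : Lp ℂ 2 (volume : Measure E)) =ᵐ[volume] 𝓕⁻ g := by
  refine ae_eq_of_forall_schwartz (continuous_fourierInv_of_integrable h1) fun φ ↦ ?_
  have e1 := congrArg (fun T : 𝓢'(E, ℂ) ↦ T φ)
    (Lp.fourierInv_toTemperedDistribution_eq (h2.toLp g))
  simp only [TemperedDistribution.fourierInv_apply, Lp.toTemperedDistribution_apply] at e1
  rw [← e1]
  -- The inverse transform is the Fourier integral for the pairing `-⟪x, y⟫`.
  have e2 := VectorFourier.integral_fourierIntegral_smul_eq_flip (L := -innerₗ E)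
    (μ := volume) (ν := volume) Real.continuous_fourierChar
    (continuous_inner (𝕜 := ℝ) (E := E)).neg φ.integrable h1
  have e3 : (-innerₗ E).flip = -innerₗ E := by
    ext x y; simp [real_inner_comm]
  rw [e3] at e2
  refine (integral_congr_ae ?_).trans e2
  filter_upwards [h2.coeFn_toLp] with x hx
  rw [hx, SchwartzMap.fourierInv_coe]
  rfl

/-- Plancherel's identity on `L¹ ∩ L²`. -/
theorem eLpNorm_fourier_eq {g : E → ℂ} (h1 : Integrable g) (h2 : MemLp g 2) :
    eLpNorm (𝓕 g) 2 volume = eLpNorm g 2 volume := by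
  rw [← eLpNorm_congr_ae (fourier_toLp_ae_eq h1 h2), ← eLpNorm_congr_ae h2.coeFn_toLp,
    ← Lp.enorm_def, ← Lp.enorm_def, ← ofReal_norm, ← ofReal_norm, Lp.norm_fourier_eq]

/-- The `L²` Fourier transform commutes with composition with a linear isometry. -/
theorem fourier_compMeasurePreserving (R : E ≃ₗᵢ[ℝ] E) (f : Lp ℂ 2 (volume : Measure E)) :
    𝓕 (Lp.compMeasurePreserving R R.measurePreserving f) =
      Lp.compMeasurePreserving R R.measurePreserving (𝓕 f) := by
  -- Both sides are continuous in `f`, so Schwartz functions suffice; there the integral formula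
  -- applies.
  refine DenseRange.induction_on
    (p := fun f : Lp ℂ 2 (volume : Measure E) ↦
      𝓕 (Lp.compMeasurePreserving R R.measurePreserving f) =
        Lp.compMeasurePreserving R R.measurePreserving (𝓕 f))
    (SchwartzMap.denseRange_toLpCLM (p := 2) ENNReal.ofNat_ne_top) f ?_ fun φ ↦ ?_
  · have hc := (Lp.isometry_compMeasurePreserving (E := ℂ) (p := 2) R.measurePreserving).continuous
    have hF := (Lp.fourierTransformₗᵢ E ℂ).continuous
    exact isClosed_eq (hF.comp hc) (hc.comp hF)
  · have hφ : MemLp (φ ∘ R) 2 volume := (φ.memLp 2 volume).comp_measurePreserving R.measurePreserving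
    have h1 : Integrable (φ ∘ R) :=
      (R.measurePreserving.integrable_comp_emb R.toHomeomorph.measurableEmbedding).2 φ.integrable
    have e1 : Lp.compMeasurePreserving R R.measurePreserving (φ.toLp 2) = hφ.toLp _ := rfl
    have e2 : Lp.compMeasurePreserving R R.measurePreserving ((𝓕 φ).toLp 2) =
      (((𝓕 φ).memLp 2 volume).comp_measurePreserving R.measurePreserving).toLp _ := rfl
    rw [SchwartzMap.toLpCLM_apply, e1, SchwartzMap.toLp_fourier_eq, e2]
    refine Lp.ext ((fourier_toLp_ae_eq h1 hφ).trans (.trans ?_ (MemLp.coeFn_toLp _).symm))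
    refine .of_forall fun x ↦ ?_
    rw [Real.fourier_comp_linearIsometry]
    rfl

end Fourier

/-- The Fourier transform of a radial function is invariant under linear isometries. -/
theorem IsRadial.fourier_comp_ae_eq {n : ℕ}
    {u : Lp ℂ 2 (volume : Measure (EuclideanSpace ℝ (Fin n)))} (hu : IsRadial u)
    (R : EuclideanSpace ℝ (Fin n) ≃ₗᵢ[ℝ] EuclideanSpace ℝ (Fin n)) :
    (𝓕 u : Lp ℂ 2 (volume : Measure (EuclideanSpace ℝ (Fin n)))) ∘ R =ᵐ[volume]
      (𝓕 u : Lp ℂ 2 (volume : Measure (EuclideanSpace ℝ (Fin n)))) := by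
  obtain ⟨v, hv⟩ := hu
  have h : Lp.compMeasurePreserving R R.measurePreserving u = u := by
    refine Lp.ext ((Lp.coeFn_compMeasurePreserving u R.measurePreserving).trans ?_)
    filter_upwards [hv, R.measurePreserving.quasiMeasurePreserving.ae hv] with x hx hx'
    rw [Function.comp_apply, hx', hx, R.norm_map]
  have := Lp.coeFn_compMeasurePreserving (𝓕 u) R.measurePreserving
  rw [← fourier_compMeasurePreserving, h] at this
  exact this.symm


/-! ### Strauss' inequality, first for radial profiles and then for band-limited functions. -/

/-- Integrability against a power weight on `(0, ∞)` implies integrability away from `0`. -/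
theorem integrableOn_Ioi_of_pow_mul {m : ℕ} {f : ℝ → ℝ} (hf : Continuous f)
    (h : IntegrableOn (fun y ↦ y ^ m * f y) (Set.Ioi 0)) {r : ℝ} (hr : 0 < r) :
    IntegrableOn f (Set.Ioi r) := by
  have h' : IntegrableOn (fun y ↦ (r ^ m)⁻¹ * (y ^ m * f y)) (Set.Ioi r) :=
    (h.mono_set (Set.Ioi_subset_Ioi hr.le)).const_mul _
  refine h'.norm.mono' hf.aestronglyMeasurable.restrict ?_
  filter_upwards [ae_restrict_mem measurableSet_Ioi] with y hy
  have hy' : r ≤ y := le_of_lt hy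
  have hy0 : 0 < y := hr.trans hy
  rw [norm_mul, norm_mul, norm_inv, norm_pow, norm_pow, Real.norm_of_nonneg hr.le,
    Real.norm_of_nonneg hy0.le, ← mul_assoc]
  refine le_mul_of_one_le_left (norm_nonneg _) ?_
  rw [inv_mul_eq_div, one_le_div (by positivity)]
  gcongr

/-- The radial Sobolev inequality of Strauss, for a radial profile `φ` with derivative `ψ`. -/
theorem radial_pow_mul_norm_sq_le {E : Type*} [NormedAddCommGroup E] [InnerProductSpace ℝ E]
    [FiniteDimensional ℝ E] [Nontrivial E] [MeasurableSpace E] [BorelSpace E] {φ ψ : ℝ → ℂ}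
    (hφ : ∀ r, HasDerivAt φ (ψ r) r) (hψ : Continuous ψ)
    (hφ2 : MemLp (fun x : E ↦ φ ‖x‖) 2 volume) (hψ2 : MemLp (fun x : E ↦ ψ ‖x‖) 2 volume)
    {r : ℝ} (hr : 0 < r) :
    Module.finrank ℝ E * (volume : Measure E).real (Metric.ball 0 1) *
      (r ^ (Module.finrank ℝ E - 1) * ‖φ r‖ ^ 2) ≤
    2 * ((eLpNorm (fun x : E ↦ φ ‖x‖) 2 volume).toReal *
      (eLpNorm (fun x : E ↦ ψ ‖x‖) 2 volume).toReal) := by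
  set m := Module.finrank ℝ E - 1 with hm
  have hφc : Continuous φ := continuous_iff_continuousAt.2 fun r ↦ (hφ r).continuousAt
  set P : ℝ → ℝ := fun r ↦ ‖φ r‖ * ‖ψ r‖ with hP
  have hPc : Continuous P := hφc.norm.mul hψ.norm
  have hFi : IntegrableOn (fun y ↦ y ^ m * ‖φ y‖ ^ 2) (Set.Ioi 0) :=
    (integrable_fun_norm_addHaar (volume : Measure E) (f := fun y ↦ ‖φ y‖ ^ 2)).1
      ((memLp_two_iff_integrable_sq_norm hφ2.1).1 hφ2)
  have hPE : Integrable (fun x : E ↦ P ‖x‖) := hφ2.norm.integrable_mul hψ2.norm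
  have hPi : IntegrableOn (fun y ↦ y ^ m * P y) (Set.Ioi 0) :=
    (integrable_fun_norm_addHaar (volume : Measure E) (f := P)).1 hPE
  have hFc : Continuous fun y ↦ ‖φ y‖ ^ 2 := hφc.norm.pow 2
  have hF' := integrableOn_Ioi_of_pow_mul hFc hFi hr
  have hP' := integrableOn_Ioi_of_pow_mul hPc hPi hr
  have hd : ∀ y, HasDerivAt (fun y ↦ ‖φ y‖ ^ 2) (2 * inner ℝ (φ y) (ψ y)) y :=
    fun y ↦ (hφ y).norm_sq
  have hdle : ∀ y, ‖2 * inner ℝ (φ y) (ψ y)‖ ≤ 2 * P y := fun y ↦ by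
    rw [norm_mul, Real.norm_ofNat]
    gcongr
    exact norm_inner_le_norm _ _
  have hdi : IntegrableOn (fun y ↦ 2 * inner ℝ (φ y) (ψ y)) (Set.Ioi r) :=
    (hP'.const_mul 2).mono' (by fun_prop) (.of_forall hdle)
  -- `‖φ‖²` and its derivative are both integrable on `(r, ∞)`, so `‖φ‖²` tends to `0` and `‖φ r‖²`
  -- is minus the integral of the derivative.
  have hlim := tendsto_zero_of_hasDerivAt_of_integrableOn_Ioi (fun y _ ↦ hd y) hdi hF'
  have hint := integral_Ioi_of_hasDerivAt_of_tendsto (a := r)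
    hFc.continuousWithinAt (fun y _ ↦ hd y) hdi hlim
  have h1 : ‖φ r‖ ^ 2 ≤ 2 * ∫ y in Set.Ioi r, P y := by
    rw [← integral_const_mul]
    calc ‖φ r‖ ^ 2 = ‖∫ y in Set.Ioi r, 2 * inner ℝ (φ y) (ψ y)‖ := by
          rw [hint, zero_sub, norm_neg, Real.norm_of_nonneg (by positivity)]
      _ ≤ _ := norm_integral_le_of_norm_le (hP'.const_mul 2) (.of_forall hdle)
  -- Since `r ≤ y`, the weight `r ^ m` is dominated by the polar density `y ^ m`.
  have h2 : r ^ m * ∫ y in Set.Ioi r, P y ≤ ∫ y in Set.Ioi 0, y ^ m * P y := by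
    rw [← integral_const_mul]
    refine (setIntegral_mono_on (hP'.const_mul _)
      (hPi.mono_set (Set.Ioi_subset_Ioi hr.le)) measurableSet_Ioi fun y hy ↦ ?_).trans
      (setIntegral_mono_set hPi ?_ (Set.Ioi_subset_Ioi hr.le).eventuallyLE)
    · have : r ≤ y := le_of_lt hy
      have : 0 ≤ P y := by positivity
      gcongr
    · filter_upwards [ae_restrict_mem measurableSet_Ioi] with y hy
      have : 0 < y := hy
      simp only [Pi.zero_apply, hP]
      positivity
  -- Cauchy–Schwarz on the whole space, written as Hölder with exponents `2, 2`.
  have h3 : ∫ x : E, P ‖x‖ ≤ (eLpNorm (fun x : E ↦ φ ‖x‖) 2 volume).toReal *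
      (eLpNorm (fun x : E ↦ ψ ‖x‖) 2 volume).toReal := by
    rw [← ENNReal.toReal_mul]
    have h4 : ∫ x : E, P ‖x‖ =
        (eLpNorm ((fun x : E ↦ φ ‖x‖) • (fun x : E ↦ ψ ‖x‖)) 1 volume).toReal := by
      rw [eLpNorm_one_eq_lintegral_enorm, ← integral_norm_eq_lintegral_enorm (hφ2.1.smul hψ2.1)]
      simp [hP]
    rw [h4]
    exact ENNReal.toReal_mono (ENNReal.mul_ne_top hφ2.eLpNorm_ne_top hψ2.eLpNorm_ne_top)
      (eLpNorm_smul_le_mul_eLpNorm hψ2.1 hφ2.1)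
  rw [integral_fun_norm_addHaar, nsmul_eq_mul, smul_eq_mul] at h3
  simp only [smul_eq_mul, ← hm] at h3
  set c := (volume : Measure E).real (Metric.ball 0 1)
  calc Module.finrank ℝ E * c * (r ^ m * ‖φ r‖ ^ 2)
      ≤ Module.finrank ℝ E * c * (r ^ m * (2 * ∫ y in Set.Ioi r, P y)) := by gcongr
    _ = 2 * (Module.finrank ℝ E * (c * (r ^ m * ∫ y in Set.Ioi r, P y))) := by ring
    _ ≤ 2 * (Module.finrank ℝ E * (c * ∫ y in Set.Ioi 0, y ^ m * P y)) := by gcongr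
    _ ≤ _ := by gcongr


/-- Transitivity on spheres lets a rotation invariant function be read off along a single ray. -/
theorem exists_linearIsometryEquiv_apply_eq {E : Type*} [NormedAddCommGroup E]
    [InnerProductSpace ℝ E] [FiniteDimensional ℝ E] {x y : E} (h : ‖x‖ = ‖y‖) :
    ∃ R : E ≃ₗᵢ[ℝ] E, R x = y :=
  ⟨(ℝ ∙ (x - y))ᗮ.reflection, Submodule.reflection_sub h⟩

/-- Strauss' inequality for the Fourier transform of a rotation invariant function supported
in a ball of radius `M`. -/
theorem pow_mul_norm_fourier_sq_le {E : Type*} [NormedAddCommGroup E] [InnerProductSpace ℝ E]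
    [FiniteDimensional ℝ E] [Nontrivial E] [MeasurableSpace E] [BorelSpace E]
    {M : ℝ} (hM : 0 ≤ M) {g : E → ℂ} (hg : MemLp g 2 volume) (hgM : ∀ ξ, M < ‖ξ‖ → g ξ = 0)
    (hgR : ∀ R : E ≃ₗᵢ[ℝ] E, g ∘ R =ᵐ[volume] g) {x : E} (hx : x ≠ 0) :
    Module.finrank ℝ E * (volume : Measure E).real (Metric.ball 0 1) *
      (‖x‖ ^ (Module.finrank ℝ E - 1) * ‖𝓕 g x‖ ^ 2) ≤
    4 * Real.pi * Module.finrank ℝ E * M * (eLpNorm g 2 volume).toReal ^ 2 := by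
  set n := Module.finrank ℝ E
  have hball : (volume : Measure E) (Metric.closedBall 0 M) ≠ ∞ := measure_closedBall_lt_top.ne
  have hint : ∀ {f : E → ℂ}, MemLp f 2 volume → (∀ ξ, M < ‖ξ‖ → f ξ = 0) → Integrable f :=
    fun hf hfM ↦ memLp_one_iff_integrable.1 <|
      hf.mono_exponent_of_measure_support_ne_top (s := Metric.closedBall 0 M)
        (fun ξ hξ ↦ hfM ξ (by simpa using hξ)) hball one_le_two
  have hgi : Integrable g := hint hg hgM
  have hvgi : Integrable fun ξ ↦ ‖ξ‖ * ‖g ξ‖ := by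
    refine (hgi.norm.const_mul M).mono' (continuous_norm.aestronglyMeasurable.mul hg.1.norm)
      (.of_forall fun ξ ↦ ?_)
    rw [norm_mul, norm_norm, norm_norm]
    rcases le_or_gt ‖ξ‖ M with h | h
    · gcongr
    · simp [hgM ξ h]
  set h : E → ℂ := 𝓕 g
  -- `G ξ v = -2πi ⟪ξ, v⟫ g ξ`, so `𝓕 G` is the Fréchet derivative of `h`.
  set G : E → E →L[ℝ] ℂ := VectorFourier.fourierSMulRight (innerSL ℝ) g
  have hD : ∀ x, HasFDerivAt h (𝓕 G x) x := Real.hasFDerivAt_fourier hgi hvgi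
  have hGi : Integrable G := by
    refine (hvgi.const_mul (2 * Real.pi * ‖innerSL ℝ (E := E)‖)).mono'
      hg.1.fourierSMulRight (.of_forall fun ξ ↦ ?_)
    refine (VectorFourier.norm_fourierSMulRight_le _ _ _).trans_eq (by ring)
  have hGc : Continuous (𝓕 G) := VectorFourier.fourierIntegral_continuous
    Real.continuous_fourierChar (L := innerₗ E) continuous_inner hGi
  -- Invariance of `g` almost everywhere becomes invariance of `h` everywhere, since the Fourier
  -- integral ignores null sets.
  have hinv : ∀ (R : E ≃ₗᵢ[ℝ] E) (y : E), h (R y) = h y := fun R y ↦ by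
    simp only [h]
    rw [← Real.fourier_comp_linearIsometry]
    exact Real.fourier_congr_ae (hgR R) y
  have hDinv : ∀ (R : E ≃ₗᵢ[ℝ] E) (y v : E), 𝓕 G (R y) (R v) = 𝓕 G y v := fun R y v ↦ by
    have h1 : HasFDerivAt (h ∘ R) ((𝓕 G (R y)).comp (R : E →L[ℝ] E)) y :=
      (hD (R y)).comp y (R : E →L[ℝ] E).hasFDerivAt
    have h2 : h ∘ R = h := funext (hinv R)
    rw [h2] at h1
    exact congrArg (fun T : E →L[ℝ] ℂ ↦ T v) (h1.unique (hD y))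
  obtain ⟨e, he⟩ : ∃ e : E, ‖e‖ = 1 := exists_norm_eq E zero_le_one
  have hrot : ∀ y : E, ∃ R : E ≃ₗᵢ[ℝ] E, R (‖y‖ • e) = y := fun y ↦
    exists_linearIsometryEquiv_apply_eq (by simp [norm_smul, he])
  have hφ : ∀ r, HasDerivAt (fun r : ℝ ↦ h (r • e)) (𝓕 G (r • e) e) r := fun r ↦ by
    have h1 : HasDerivAt (fun r : ℝ ↦ r • e) e r := by
      simpa using (hasDerivAt_id r).smul_const e
    exact (hD (r • e)).comp_hasDerivAt r h1
  have hψ : Continuous fun r : ℝ ↦ 𝓕 G (r • e) e :=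
    (hGc.comp (continuous_id.smul continuous_const)).clm_apply continuous_const
  have hφe : (fun y : E ↦ h (‖y‖ • e)) = h := funext fun y ↦ by
    obtain ⟨R, hR⟩ := hrot y
    rw [← hinv R, hR]
  let b := stdOrthonormalBasis ℝ E
  -- Bernstein's bound: on the support of `g` the multiplier `2π ⟪ξ, b i⟫` is at most `2πM`.
  have hcoord : ∀ i, MemLp (fun ξ ↦ G ξ (b i)) 2 volume ∧
      eLpNorm (fun ξ ↦ G ξ (b i)) 2 volume ≤
        ENNReal.ofReal (2 * Real.pi * M) * eLpNorm g 2 volume := fun i ↦ by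
    have hb : ∀ ξ, ‖G ξ (b i)‖ ≤ 2 * Real.pi * M * ‖g ξ‖ := fun ξ ↦ by
      rcases le_or_gt ‖ξ‖ M with hξ | hξ
      · have : |inner ℝ ξ (b i)| ≤ M := by
          refine (abs_real_inner_le_norm _ _).trans ?_
          simpa [b.norm_eq_one] using hξ
        simp only [G, VectorFourier.fourierSMulRight_apply, norm_neg, norm_smul]
        simp only [norm_mul, Complex.norm_I, Complex.norm_real, Real.norm_eq_abs, Complex.norm_ofNat,
          abs_of_pos Real.pi_pos, mul_one]
        rw [← mul_assoc]
        gcongr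
        exact this
      · simp [G, VectorFourier.fourierSMulRight_apply, hgM ξ hξ]
    have hm : AEStronglyMeasurable (fun ξ ↦ G ξ (b i)) volume :=
      (ContinuousLinearMap.apply ℝ ℂ (b i)).continuous.comp_aestronglyMeasurable hGi.1
    exact ⟨hg.of_le_mul hm (.of_forall hb), eLpNorm_le_mul_eLpNorm_of_ae_le_mul (.of_forall hb) 2⟩
  have hGM : ∀ i ξ, M < ‖ξ‖ → G ξ (b i) = 0 := fun i ξ hξ ↦ by
    simp [G, VectorFourier.fourierSMulRight_apply, hgM ξ hξ]
  have hFG : ∀ i, (fun y ↦ 𝓕 G y (b i)) = 𝓕 fun ξ ↦ G ξ (b i) := fun i ↦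
    funext fun y ↦ Real.fourier_continuousLinearMap_apply hGi
  have hFle : ∀ i, eLpNorm (fun y ↦ 𝓕 G y (b i)) 2 volume ≤
      ENNReal.ofReal (2 * Real.pi * M) * eLpNorm g 2 volume := fun i ↦ by
    rw [hFG, eLpNorm_fourier_eq (hint (hcoord i).1 (hGM i)) (hcoord i).1]
    exact (hcoord i).2
  have hFm : ∀ i, AEStronglyMeasurable (fun y ↦ ‖𝓕 G y (b i)‖) volume := fun i ↦
    (hGc.clm_apply continuous_const).norm.aestronglyMeasurable
  -- Rotating `‖y‖ • e` to `y` turns the radial derivative into `𝓕 G y (R e)`. The coordinates of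
  -- the unit vector `R e` are at most `1`, so summing over the basis costs a factor `n`.
  have hψle : eLpNorm (fun y : E ↦ 𝓕 G (‖y‖ • e) e) 2 volume ≤
      n * (ENNReal.ofReal (2 * Real.pi * M) * eLpNorm g 2 volume) := by
    calc eLpNorm (fun y : E ↦ 𝓕 G (‖y‖ • e) e) 2 volume
        ≤ eLpNorm (∑ i, fun y ↦ ‖𝓕 G y (b i)‖) 2 volume := by
          refine eLpNorm_mono_real fun y ↦ ?_
          obtain ⟨R, hR⟩ := hrot y
          rw [← hDinv R, hR, Finset.sum_apply]
          nth_rw 1 [← b.sum_repr' (R e)]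
          rw [map_sum]
          refine norm_sum_le_of_le _ fun i _ ↦ ?_
          rw [map_smul, norm_smul]
          refine mul_le_of_le_one_left (norm_nonneg _) ?_
          refine (norm_inner_le_norm _ _).trans_eq ?_
          rw [b.norm_eq_one, R.norm_map, he, one_mul]
      _ ≤ ∑ i, eLpNorm (fun y ↦ ‖𝓕 G y (b i)‖) 2 volume :=
          eLpNorm_sum_le (fun i _ ↦ hFm i) one_le_two
      _ ≤ ∑ _i : Fin n, ENNReal.ofReal (2 * Real.pi * M) * eLpNorm g 2 volume :=
          Finset.sum_le_sum fun i _ ↦ by rw [eLpNorm_norm]; exact hFle i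
      _ = _ := by simp
  have hψfin : n * (ENNReal.ofReal (2 * Real.pi * M) * eLpNorm g 2 volume) ≠ ∞ :=
    ENNReal.mul_ne_top (ENNReal.natCast_ne_top n)
      (ENNReal.mul_ne_top ENNReal.ofReal_ne_top hg.eLpNorm_ne_top)
  have hφ2 : MemLp (fun y : E ↦ h (‖y‖ • e)) 2 volume := by
    rw [hφe]
    exact ⟨(continuous_fourier_of_integrable hgi).aestronglyMeasurable, by
      rw [eLpNorm_fourier_eq hgi hg]; exact hg.eLpNorm_lt_top⟩
  have hψ2 : MemLp (fun y : E ↦ 𝓕 G (‖y‖ • e) e) 2 volume :=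
    ⟨(hψ.comp continuous_norm).aestronglyMeasurable, hψle.trans_lt hψfin.lt_top⟩
  have key := radial_pow_mul_norm_sq_le hφ hψ hφ2 hψ2 (norm_pos_iff.2 hx)
  rw [hφe, eLpNorm_fourier_eq hgi hg] at key
  rw [show h (‖x‖ • e) = h x from congrFun hφe x] at key
  refine key.trans ?_
  have h5 := ENNReal.toReal_mono hψfin hψle
  rw [ENNReal.toReal_mul, ENNReal.toReal_mul, ENNReal.toReal_natCast,
    ENNReal.toReal_ofReal (by positivity)] at h5
  calc _ ≤ 2 * ((eLpNorm g 2 volume).toReal *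
        (n * (2 * Real.pi * M * (eLpNorm g 2 volume).toReal))) := by gcongr
    _ = _ := by ring

/-- Strauss' inequality for the inverse Fourier transform of a band-limited rotation invariant
function, with a constant depending on the dimension only. -/
theorem exists_norm_rpow_mul_norm_fourierInv_le {n : ℕ} (hn : 2 ≤ n) :
    ∃ K : ℝ, 0 < K ∧ ∀ {M : ℝ}, 0 ≤ M → ∀ {g : EuclideanSpace ℝ (Fin n) → ℂ},
      MemLp g 2 volume → (∀ ξ, M < ‖ξ‖ → g ξ = 0) →
      (∀ R : EuclideanSpace ℝ (Fin n) ≃ₗᵢ[ℝ] EuclideanSpace ℝ (Fin n), g ∘ R =ᵐ[volume] g) →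
      ∀ x, ‖x‖ ^ (((n : ℝ) - 1) / 2) * ‖𝓕⁻ g x‖ ≤
        K * √M * (eLpNorm g 2 volume).toReal := by
  set c : ℝ := (volume : Measure (EuclideanSpace ℝ (Fin n))).real (Metric.ball 0 1)
  have hc : 0 < c := ENNReal.toReal_pos (Metric.measure_ball_pos _ _ one_pos).ne'
    measure_ball_lt_top.ne
  refine ⟨√(4 * Real.pi / c), by positivity, fun {M} hM {g} hg hgM hgR x ↦ ?_⟩
  have hn1 : (1 : ℝ) < n := by exact_mod_cast hn
  rcases eq_or_ne x 0 with rfl | hx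
  -- The weight vanishes at the origin because `n ≥ 2` makes the exponent positive.
  · rw [norm_zero, Real.zero_rpow (by linarith), zero_mul]
    positivity
  have : Nontrivial (EuclideanSpace ℝ (Fin n)) := ⟨x, 0, hx⟩
  have key := pow_mul_norm_fourier_sq_le hM hg hgM hgR (neg_ne_zero.2 hx)
  rw [norm_neg, ← Real.fourierInv_eq_fourier_neg, finrank_euclideanSpace_fin] at key
  have hpow : (‖x‖ ^ (((n : ℝ) - 1) / 2)) ^ 2 = ‖x‖ ^ (n - 1) := by
    rw [← Real.rpow_natCast, ← Real.rpow_mul (norm_nonneg x), ← Real.rpow_natCast,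
      Nat.cast_sub (by lia)]
    norm_num
  rw [← Real.sqrt_mul (by positivity)]
  refine le_of_sq_le_sq ?_ (by positivity)
  rw [mul_pow, mul_pow, hpow, Real.sq_sqrt (by positivity), div_mul_eq_mul_div, div_mul_eq_mul_div,
    le_div_iff₀ hc]
  have hn0 : (0 : ℝ) < n := by linarith
  -- The factor `n` from the coordinate sum cancels the one from polar coordinates.
  refine le_of_mul_le_mul_left (le_of_eq_of_le ?_ (key.trans_eq ?_)) hn0 <;> ring


/-! ### Summation of a sequence with an `ℓ²` bound and geometric decay. -/

/-- The Brezis–Gallouet summation argument: an `ℓ²` bound for `b` by `A` together with geometric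
decay of `b` of size `B` bounds the sums of `b` by `A √log (2 + B / A)`. -/
theorem exists_sum_range_le_mul_sqrt_log {D q : ℝ} (hD : 0 ≤ D) (hq0 : 0 < q) (hq1 : q < 1) :
    ∃ C : ℝ, 0 < C ∧ ∀ (b : ℕ → ℝ) (A B : ℝ), (∀ k, 0 ≤ b k) → 0 < A → A ≤ B →
      (∀ N, ∑ k ∈ Finset.range N, b k ^ 2 ≤ 2 * A ^ 2) → (∀ k, b k ≤ D * B * q ^ k) →
      ∀ N, ∑ k ∈ Finset.range N, b k ≤ C * A * √(Real.log (2 + B / A)) := by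
  have hlq : 0 < -Real.log q := neg_pos.2 (Real.log_neg hq0 hq1)
  have h1q : 0 < 1 - q := sub_pos.2 hq1
  refine ⟨√(2 * (1 / -Real.log q + 1)) + D / (1 - q), by positivity,
    fun b A B hb hA hAB hsum hdecay N ↦ ?_⟩
  have hB : 0 < B := hA.trans_le hAB
  have hBA : 1 ≤ B / A := (one_le_div hA).2 hAB
  set ℓ := Real.log (2 + B / A) with hℓ
  -- As `e < 3 ≤ 2 + B / A`, additive constants can be absorbed into `ℓ`.
  have hℓ1 : 1 ≤ ℓ := by
    rw [hℓ, Real.le_log_iff_exp_le (by positivity)]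
    linarith [Real.exp_one_lt_three]
  -- The cutoff `m` is where the geometric bound `B q ^ m` has dropped to `A`.
  obtain ⟨m, hm, hmℓ⟩ : ∃ m : ℕ, B * q ^ m ≤ A ∧ (m : ℝ) ≤ (1 / -Real.log q + 1) * ℓ := by
    refine ⟨⌈Real.log (B / A) / -Real.log q⌉₊, ?_, ?_⟩
    · have h1 : Real.log (B / A) ≤ ⌈Real.log (B / A) / -Real.log q⌉₊ * -Real.log q :=
        (div_le_iff₀ hlq).1 (Nat.le_ceil _)
      set m := ⌈Real.log (B / A) / -Real.log q⌉₊
      have h2 : Real.log (B / A * q ^ m) ≤ 0 := by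
        rw [Real.log_mul (by positivity) (by positivity), Real.log_pow]
        linarith
      have h3 := (Real.log_nonpos_iff (by positivity)).1 h2
      rwa [div_mul_eq_mul_div, div_le_one hA] at h3
    · have h1 : Real.log (B / A) ≤ ℓ := Real.log_le_log (by positivity) (by linarith)
      refine (Nat.ceil_lt_add_one (div_nonneg (Real.log_nonneg hBA) hlq.le)).le.trans ?_
      calc Real.log (B / A) / -Real.log q + 1 ≤ ℓ / -Real.log q + ℓ := by gcongr
        _ = _ := by ring
  have hlow : ∑ k ∈ Finset.range m, b k ≤ √(2 * (1 / -Real.log q + 1)) * A * √ℓ := by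
    have h1 := sq_sum_le_card_mul_sum_sq (s := Finset.range m) (f := b)
    rw [Finset.card_range] at h1
    refine le_of_sq_le_sq ?_ (by positivity)
    rw [mul_pow, mul_pow, Real.sq_sqrt (by positivity), Real.sq_sqrt (by positivity)]
    calc _ ≤ (m : ℝ) * ∑ k ∈ Finset.range m, b k ^ 2 := h1
      _ ≤ ((1 / -Real.log q + 1) * ℓ) * (2 * A ^ 2) := by
        have := hsum m
        gcongr
      _ = _ := by ring
  have hhigh : ∑ j ∈ Finset.range N, b (m + j) ≤ D / (1 - q) * A * √ℓ := by
    calc ∑ j ∈ Finset.range N, b (m + j) ≤ ∑ j ∈ Finset.range N, D * A * q ^ j := by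
          refine Finset.sum_le_sum fun j _ ↦ (hdecay _).trans ?_
          calc D * B * q ^ (m + j) = D * (B * q ^ m) * q ^ j := by ring
            _ ≤ _ := by gcongr
      _ = D * A * ∑ j ∈ Finset.range N, q ^ j := by rw [Finset.mul_sum]
      _ ≤ D * A * (1 - q)⁻¹ := by
          gcongr
          rw [← tsum_geometric_of_lt_one hq0.le hq1]
          exact (summable_geometric_of_lt_one hq0.le hq1).sum_le_tsum _ fun _ _ ↦ by positivity
      _ = D / (1 - q) * A * 1 := by ring
      _ ≤ _ := by
          gcongr
          exact Real.one_le_sqrt.2 hℓ1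
  -- Enlarging the range to `m + N` avoids comparing `N` with `m`.
  calc ∑ k ∈ Finset.range N, b k ≤ ∑ k ∈ Finset.range (m + N), b k :=
        Finset.sum_le_sum_of_subset_of_nonneg
          (Finset.range_subset_range.2 (Nat.le_add_left N m)) fun k _ _ ↦ hb k
    _ = ∑ k ∈ Finset.range m, b k + ∑ j ∈ Finset.range N, b (m + j) := Finset.sum_range_add _ _ _
    _ ≤ _ := (add_le_add hlow hhigh).trans_eq (by ring)

/-! ### Dyadic shells in frequency. -/

/-- The index of the dyadic shell `2 ^ k ≤ 1 + ‖ξ‖ < 2 ^ (k + 1)` that contains `ξ`. -/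
noncomputable def shellIndex {E : Type*} [NormedAddCommGroup E] (ξ : E) : ℕ :=
  Nat.log 2 ⌊1 + ‖ξ‖⌋₊

section Shell

variable {E : Type*} [NormedAddCommGroup E]

theorem two_pow_shellIndex_le (ξ : E) : (2 : ℝ) ^ shellIndex ξ ≤ 1 + ‖ξ‖ := by
  have h : ⌊1 + ‖ξ‖⌋₊ ≠ 0 := (Nat.floor_pos.2 (by linarith [norm_nonneg ξ])).ne'
  have h1 : ((2 ^ shellIndex ξ : ℕ) : ℝ) ≤ ⌊1 + ‖ξ‖⌋₊ :=
    Nat.cast_le.2 (Nat.pow_log_le_self 2 h)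
  rw [Nat.cast_pow, Nat.cast_ofNat] at h1
  exact h1.trans (Nat.floor_le (by positivity))

theorem norm_lt_two_pow_shellIndex (ξ : E) : ‖ξ‖ < 2 ^ (shellIndex ξ + 1) := by
  have h1 : ⌊1 + ‖ξ‖⌋₊ < 2 ^ (shellIndex ξ + 1) := Nat.lt_pow_succ_log_self one_lt_two _
  rw [Nat.floor_lt (by positivity)] at h1
  push_cast at h1
  linarith

theorem measurable_shellIndex [MeasurableSpace E] [OpensMeasurableSpace E] :
    Measurable (shellIndex : E → ℕ) :=
  (measurable_of_countable (Nat.log 2)).comp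
    (Nat.measurable_floor.comp (measurable_norm.const_add 1))

theorem sum_range_indicator_shell {F : Type*} [AddCommMonoid F] (f : E → F) (N : ℕ) (ξ : E) :
    ∑ k ∈ Finset.range N, {ξ : E | shellIndex ξ = k}.indicator f ξ =
      {ξ : E | shellIndex ξ < N}.indicator f ξ := by
  simp [Set.indicator_apply, Finset.sum_ite_eq]

/-- On each shell the Bessel weight is comparable to the dyadic frequency. -/
theorem two_pow_shellIndex_rpow_le {s : ℝ} (hs : 0 ≤ s) (ξ : E) :
    ((2 : ℝ) ^ shellIndex ξ) ^ s ≤ 2 ^ s * (1 + (2 * Real.pi * ‖ξ‖) ^ 2) ^ (s / 2) := by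
  have h1 : (2 : ℝ) ^ shellIndex ξ ≤ 2 * (1 + (2 * Real.pi * ‖ξ‖) ^ 2) ^ (1 / 2 : ℝ) := by
    refine (two_pow_shellIndex_le ξ).trans ?_
    rw [← Real.sqrt_eq_rpow]
    refine le_of_sq_le_sq ?_ (by positivity)
    rw [mul_pow, Real.sq_sqrt (by positivity)]
    have hpi : 1 ≤ (2 * Real.pi) ^ 2 := one_le_pow₀ (by linarith [Real.pi_gt_three])
    have h2 : ‖ξ‖ ^ 2 ≤ (2 * Real.pi * ‖ξ‖) ^ 2 := by
      rw [mul_pow]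
      exact le_mul_of_one_le_left (by positivity) hpi
    nlinarith [sq_nonneg (‖ξ‖ - 1)]
  calc ((2 : ℝ) ^ shellIndex ξ) ^ s
      ≤ (2 * (1 + (2 * Real.pi * ‖ξ‖) ^ 2) ^ (1 / 2 : ℝ)) ^ s := by gcongr
    _ = _ := by
      rw [Real.mul_rpow (by positivity) (by positivity), ← Real.rpow_mul (by positivity)]
      ring_nf

end Shell


/-! ### Dyadic pieces of `u` and their Sobolev bounds. -/

theorem toReal_eLpNorm_two_sq {α : Type*} [MeasurableSpace α] {μ : Measure α} {f : α → ℂ}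
    (hf : MemLp f 2 μ) : (eLpNorm f 2 μ).toReal ^ 2 = ∫ x, ‖f x‖ ^ 2 ∂μ := by
  rw [hf.eLpNorm_eq_integral_rpow_norm two_ne_zero ENNReal.ofNat_ne_top,
    ENNReal.toReal_ofReal (by positivity)]
  simp only [ENNReal.toReal_ofNat, Real.rpow_ofNat]
  rw [← Real.rpow_natCast, ← Real.rpow_mul (integral_nonneg fun _ ↦ by positivity)]
  norm_num

variable {n : ℕ}

/-- The part of `𝓕 u` with frequencies in the `k`-th dyadic shell. -/
noncomputable def shellPart (u : Lp ℂ 2 (volume : Measure (EuclideanSpace ℝ (Fin n)))) (k : ℕ) :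
    EuclideanSpace ℝ (Fin n) → ℂ :=
  {ξ | shellIndex ξ = k}.indicator
    (𝓕 u : Lp ℂ 2 (volume : Measure (EuclideanSpace ℝ (Fin n))))

/-- The part of `𝓕 u` with frequencies in the first `N` dyadic shells. -/
noncomputable def lowPart (u : Lp ℂ 2 (volume : Measure (EuclideanSpace ℝ (Fin n)))) (N : ℕ) :
    EuclideanSpace ℝ (Fin n) → ℂ :=
  {ξ | shellIndex ξ < N}.indicator
    (𝓕 u : Lp ℂ 2 (volume : Measure (EuclideanSpace ℝ (Fin n))))

variable (u : Lp ℂ 2 (volume : Measure (EuclideanSpace ℝ (Fin n))))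

theorem memLp_shellPart (k : ℕ) : MemLp (shellPart u k) 2 volume :=
  (Lp.memLp _).indicator (measurable_shellIndex (measurableSet_singleton k))

theorem memLp_lowPart (N : ℕ) : MemLp (lowPart u N) 2 volume :=
  (Lp.memLp _).indicator (measurable_shellIndex measurableSet_Iio)

theorem shellPart_eq_zero {k : ℕ} {ξ : EuclideanSpace ℝ (Fin n)} (h : 2 ^ (k + 1) < ‖ξ‖) :
    shellPart u k ξ = 0 := by
  refine Set.indicator_of_notMem (fun hk ↦ ?_) _
  have := norm_lt_two_pow_shellIndex ξ
  rw [show shellIndex ξ = k from hk] at this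
  exact this.not_gt h

/-- A shell has finite measure, so `L²` gives `L¹`; the inverse transform of a piece is then a
genuine integral, defined at every point. -/
theorem integrable_shellPart (k : ℕ) : Integrable (shellPart u k) :=
  memLp_one_iff_integrable.1 <|
    (memLp_shellPart u k).mono_exponent_of_measure_support_ne_top
      (s := Metric.closedBall 0 (2 ^ (k + 1)))
      (fun ξ hξ ↦ shellPart_eq_zero u (by simpa using hξ)) measure_closedBall_lt_top.ne one_le_two

theorem lowPart_eq_sum (N : ℕ) : lowPart u N = fun ξ ↦ ∑ k ∈ Finset.range N, shellPart u k ξ :=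
  funext fun ξ ↦ (sum_range_indicator_shell _ N ξ).symm

theorem integrable_lowPart (N : ℕ) : Integrable (lowPart u N) := by
  rw [lowPart_eq_sum]
  exact integrable_finsetSum _ fun k _ ↦ integrable_shellPart u k

theorem fourierInv_lowPart (N : ℕ) (x : EuclideanSpace ℝ (Fin n)) :
    𝓕⁻ (lowPart u N) x = ∑ k ∈ Finset.range N, 𝓕⁻ (shellPart u k) x := by
  simp only [lowPart_eq_sum, Real.fourierInv_eq_fourier_neg, Real.fourier_eq, Finset.smul_sum]
  exact integral_finsetSum _ fun k _ ↦
    (Real.fourierIntegral_convergent_iff _).2 (integrable_shellPart u k)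

theorem norm_besselFourier (s : ℝ) (ξ : EuclideanSpace ℝ (Fin n)) :
    ‖besselFourier s u ξ‖ = (1 + (2 * Real.pi * ‖ξ‖) ^ 2) ^ (s / 2) *
      ‖(𝓕 u : Lp ℂ 2 (volume : Measure (EuclideanSpace ℝ (Fin n)))) ξ‖ := by
  rw [besselFourier, norm_mul, Complex.norm_real, Real.norm_of_nonneg (by positivity)]

theorem aestronglyMeasurable_besselFourier (s : ℝ) :
    AEStronglyMeasurable (besselFourier s u) volume := by
  have hb : Measurable fun ξ : EuclideanSpace ℝ (Fin n) ↦
      (((1 + (2 * Real.pi * ‖ξ‖) ^ 2) ^ (s / 2) : ℝ) : ℂ) := by fun_prop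
  exact hb.aestronglyMeasurable.mul (Lp.aestronglyMeasurable _)

theorem norm_besselFourier_mono {s t : ℝ} (h : s ≤ t) (ξ : EuclideanSpace ℝ (Fin n)) :
    ‖besselFourier s u ξ‖ ≤ ‖besselFourier t u ξ‖ := by
  rw [norm_besselFourier, norm_besselFourier]
  gcongr
  linarith [sq_nonneg (2 * Real.pi * ‖ξ‖)]

variable {u}

theorem memLp_besselFourier_mono {s t : ℝ} (h : s ≤ t) (ht : MemLp (besselFourier t u) 2 volume) :
    MemLp (besselFourier s u) 2 volume :=
  ht.mono (aestronglyMeasurable_besselFourier u s) (.of_forall (norm_besselFourier_mono u h))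

theorem sobolevNorm_mono {s t : ℝ} (h : s ≤ t) (ht : MemLp (besselFourier t u) 2 volume) :
    sobolevNorm s u ≤ sobolevNorm t u :=
  ENNReal.toReal_mono ht.eLpNorm_ne_top (eLpNorm_mono (norm_besselFourier_mono u h))

/-- The Bessel weight is positive, so `𝓕 u` vanishes almost everywhere. This settles the case where
the quotient of norms is degenerate. -/
theorem eq_zero_of_sobolevNorm_eq_zero {s : ℝ} (h : MemLp (besselFourier s u) 2 volume)
    (h0 : sobolevNorm s u = 0) : u = 0 := by
  have h1 : eLpNorm (besselFourier s u) 2 volume = 0 :=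
    (ENNReal.toReal_eq_zero_iff _).1 h0 |>.resolve_right h.eLpNorm_ne_top
  have h2 : (𝓕 u : Lp ℂ 2 (volume : Measure (EuclideanSpace ℝ (Fin n)))) = 0 := by
    refine Lp.eq_zero_iff_ae_eq_zero.2 ?_
    filter_upwards [(eLpNorm_eq_zero_iff h.1 two_ne_zero).1 h1] with ξ hξ
    have h3 := norm_besselFourier u s ξ
    rw [hξ, Pi.zero_apply, norm_zero, zero_eq_mul] at h3
    exact norm_eq_zero.1 (h3.resolve_left (by positivity))
  rw [← norm_eq_zero, ← Lp.norm_fourier_eq, h2, norm_zero]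

/-- Almost orthogonality of the dyadic pieces in `H^(1/2)`. -/
theorem sum_sqrt_mul_shellPart_sq_le (h : MemLp (besselFourier (1 / 2) u) 2 volume) (N : ℕ) :
    ∑ k ∈ Finset.range N, (√(2 ^ k) * (eLpNorm (shellPart u k) 2 volume).toReal) ^ 2 ≤
      2 * sobolevNorm (1 / 2) u ^ 2 := by
  have hi : ∀ k, Integrable fun ξ ↦ (2 : ℝ) ^ k * ‖shellPart u k ξ‖ ^ 2 := fun k ↦
    ((memLp_two_iff_integrable_sq_norm (memLp_shellPart u k).1).1 (memLp_shellPart u k)).const_mul _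
  have h1 : ∀ k, (√(2 ^ k) * (eLpNorm (shellPart u k) 2 volume).toReal) ^ 2 =
      ∫ ξ, (2 : ℝ) ^ k * ‖shellPart u k ξ‖ ^ 2 := fun k ↦ by
    rw [mul_pow, Real.sq_sqrt (by positivity), toReal_eLpNorm_two_sq (memLp_shellPart u k),
      integral_const_mul]
  rw [Finset.sum_congr rfl fun k _ ↦ h1 k, ← integral_finsetSum _ fun k _ ↦ hi k, sobolevNorm,
    toReal_eLpNorm_two_sq h, ← integral_const_mul]
  refine integral_mono (integrable_finsetSum _ fun k _ ↦ hi k)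
    (((memLp_two_iff_integrable_sq_norm h.1).1 h).const_mul 2) fun ξ ↦ ?_
  -- At each `ξ` only the shell containing it contributes, so the sum collapses to at most one term.
  have h2 : ∀ k, (2 : ℝ) ^ k * ‖shellPart u k ξ‖ ^ 2 = {ξ | shellIndex ξ = k}.indicator
      (fun ξ ↦ (2 : ℝ) ^ shellIndex ξ *
        ‖(𝓕 u : Lp ℂ 2 (volume : Measure (EuclideanSpace ℝ (Fin n)))) ξ‖ ^ 2) ξ := fun k ↦ by
    by_cases hk : shellIndex ξ = k
    · simp [shellPart, hk]
    · simp [shellPart, hk]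
  simp only [h2]
  rw [sum_range_indicator_shell]
  refine (Set.indicator_le_self' (fun _ _ ↦ by positivity) ξ).trans ?_
  rw [norm_besselFourier, mul_pow, ← mul_assoc]
  gcongr
  -- The constant `2` is the square of the `2 ^ s` of the weight comparison at `s = 1 / 2`.
  have h3 := pow_le_pow_left₀ (by positivity)
    (two_pow_shellIndex_rpow_le (by norm_num : (0 : ℝ) ≤ 1 / 2) ξ) 2
  rw [mul_pow, ← Real.sqrt_eq_rpow, Real.sq_sqrt (by positivity), ← Real.sqrt_eq_rpow,
    Real.sq_sqrt (by positivity)] at h3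
  exact h3

/-- Frequencies of size at least `2 ^ k` contribute at most `2 ^ (-s k) ‖u‖_{H^s}` in `L²`. -/
theorem eLpNorm_indicator_fourier_le {s : ℝ} (hs : 0 ≤ s)
    (h : MemLp (besselFourier s u) 2 volume) (k : ℕ) {S : Set (EuclideanSpace ℝ (Fin n))}
    (hS : ∀ ξ ∈ S, k ≤ shellIndex ξ) :
    (eLpNorm (S.indicator (𝓕 u : Lp ℂ 2 (volume : Measure (EuclideanSpace ℝ (Fin n))))) 2
      volume).toReal ≤ 2 ^ s * ((2 : ℝ) ^ (-s)) ^ k * sobolevNorm s u := by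
  have h1 : ∀ ξ, ‖S.indicator (𝓕 u : Lp ℂ 2 (volume : Measure (EuclideanSpace ℝ (Fin n)))) ξ‖ ≤
      2 ^ s * ((2 : ℝ) ^ (-s)) ^ k * ‖besselFourier s u ξ‖ := fun ξ ↦ by
    by_cases hξ : ξ ∈ S
    · rw [Set.indicator_of_mem hξ, norm_besselFourier, ← mul_assoc]
      refine le_mul_of_one_le_left (norm_nonneg _) ?_
      have h2 : ((2 : ℝ) ^ k) ^ s ≤ 2 ^ s * (1 + (2 * Real.pi * ‖ξ‖) ^ 2) ^ (s / 2) := by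
        refine le_trans ?_ (two_pow_shellIndex_rpow_le hs ξ)
        have := hS ξ hξ
        gcongr
        exact one_le_two
      have h3 : ((2 : ℝ) ^ (-s)) ^ k * ((2 : ℝ) ^ k) ^ s = 1 := by
        rw [← Real.rpow_natCast, ← Real.rpow_natCast, ← Real.rpow_mul zero_le_two,
          ← Real.rpow_mul zero_le_two, ← Real.rpow_add two_pos]
        ring_nf
        simp
      calc 1 = ((2 : ℝ) ^ (-s)) ^ k * ((2 : ℝ) ^ k) ^ s := h3.symm
        _ ≤ ((2 : ℝ) ^ (-s)) ^ k * (2 ^ s * (1 + (2 * Real.pi * ‖ξ‖) ^ 2) ^ (s / 2)) := by gcongr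
        _ = _ := by ring
    · rw [Set.indicator_of_notMem hξ, norm_zero]
      positivity
  have h2 := ENNReal.toReal_mono (ENNReal.mul_ne_top ENNReal.ofReal_ne_top h.eLpNorm_ne_top)
    (eLpNorm_le_mul_eLpNorm_of_ae_le_mul (.of_forall h1) 2)
  rwa [ENNReal.toReal_mul, ENNReal.toReal_ofReal (by positivity)] at h2

/-- The low frequency parts converge to `u` in `L²`. -/
theorem tendsto_fourierInv_lowPart {s : ℝ} (hs : 0 < s)
    (h : MemLp (besselFourier s u) 2 volume) :
    Filter.Tendsto (fun N ↦ (𝓕⁻ ((memLp_lowPart u N).toLp _) :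
      Lp ℂ 2 (volume : Measure (EuclideanSpace ℝ (Fin n))))) Filter.atTop (nhds u) := by
  have h1 : Filter.Tendsto (fun N ↦ (memLp_lowPart u N).toLp _) Filter.atTop (nhds (𝓕 u)) := by
    have hq : (2 : ℝ) ^ (-s) < 1 := Real.rpow_lt_one_of_one_lt_of_neg one_lt_two (by linarith)
    have h2 := ((tendsto_pow_atTop_nhds_zero_of_lt_one (by positivity) hq).const_mul
      (2 ^ s)).mul_const (sobolevNorm s u)
    rw [mul_zero, zero_mul] at h2
    refine tendsto_iff_norm_sub_tendsto_zero.2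
      (squeeze_zero (fun _ ↦ norm_nonneg _) (fun N ↦ ?_) h2)
    -- The truncation error is exactly the part of `𝓕 u` on shells of index at least `N`.
    refine le_trans (le_of_eq ?_) (eLpNorm_indicator_fourier_le hs.le h N
      (S := {ξ | N ≤ shellIndex ξ}) fun ξ hξ ↦ hξ)
    rw [norm_sub_rev, Lp.norm_def]
    congr 1
    refine eLpNorm_congr_ae ?_
    filter_upwards [Lp.coeFn_sub (𝓕 u) ((memLp_lowPart u N).toLp _),
      (memLp_lowPart u N).coeFn_toLp] with ξ h3 h4
    rw [h3, Pi.sub_apply, h4, lowPart]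
    by_cases hξ : shellIndex ξ < N
    · simp [hξ]
    · simp [hξ, not_lt.1 hξ]
  have h2 := ((Lp.fourierTransformₗᵢ (EuclideanSpace ℝ (Fin n)) ℂ).symm.continuous.tendsto
    (𝓕 u)).comp h1
  have h3 : (Lp.fourierTransformₗᵢ (EuclideanSpace ℝ (Fin n)) ℂ).symm (𝓕 u) = u :=
    (Lp.fourierTransformₗᵢ (EuclideanSpace ℝ (Fin n)) ℂ).symm_apply_apply u
  rw [h3] at h2
  exact h2

/-- Isometries preserve each shell, so the sharp cutoff keeps the invariance that Strauss'
inequality needs. -/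
theorem IsRadial.shellPart_comp_ae_eq (hu : IsRadial u) (k : ℕ)
    (R : EuclideanSpace ℝ (Fin n) ≃ₗᵢ[ℝ] EuclideanSpace ℝ (Fin n)) :
    shellPart u k ∘ R =ᵐ[volume] shellPart u k := by
  filter_upwards [hu.fourier_comp_ae_eq R] with ξ hξ
  have : shellIndex (R ξ) = shellIndex ξ := by simp [shellIndex]
  simp only [Function.comp_apply] at hξ
  simp only [Function.comp_apply, shellPart, Set.indicator_apply, Set.mem_ofPred_eq, this, hξ]

/-! ### From the pieces to `u`, and the two estimates. -/

/-- A uniform weighted bound for the sums of dyadic pieces passes to `u`. -/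
theorem eLpNorm_top_le_of_sum_le {s B : ℝ} (hs : 0 < s)
    (h : MemLp (besselFourier s u) 2 volume)
    (hB : ∀ N x, ∑ k ∈ Finset.range N,
      ‖x‖ ^ (((n : ℝ) - 1) / 2) * ‖𝓕⁻ (shellPart u k) x‖ ≤ B) :
    eLpNorm (fun x ↦ ((‖x‖ ^ (((n : ℝ) - 1) / 2) : ℝ) : ℂ) * u x) ∞ volume ≤
      ENNReal.ofReal B := by
  -- `L²` convergence gives almost everywhere convergence along a subsequence, which suffices
  -- because `B` does not depend on `N`.
  obtain ⟨ns, -, hns⟩ :=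
    (tendstoInMeasure_of_tendsto_Lp (tendsto_fourierInv_lowPart hs h)).exists_seq_tendsto_ae
  have h1 : ∀ᵐ x, ∀ N, (𝓕⁻ ((memLp_lowPart u N).toLp _) :
      Lp ℂ 2 (volume : Measure (EuclideanSpace ℝ (Fin n)))) x = 𝓕⁻ (lowPart u N) x :=
    ae_all_iff.2 fun N ↦ fourierInv_toLp_ae_eq (integrable_lowPart u N) (memLp_lowPart u N)
  rw [eLpNorm_exponent_top]
  refine eLpNormEssSup_le_of_ae_bound ?_
  filter_upwards [hns, h1] with x hx hx1
  refine le_of_tendsto (hx.const_mul (((‖x‖ ^ (((n : ℝ) - 1) / 2) : ℝ) : ℂ))).norm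
    (.of_forall fun i ↦ ?_)
  rw [hx1, fourierInv_lowPart, norm_mul, Complex.norm_real, Real.norm_of_nonneg (by positivity)]
  refine le_trans ?_ (hB (ns i) x)
  rw [← Finset.mul_sum]
  gcongr
  exact norm_sum_le _ _

/-- The logarithmic estimate. -/
theorem exists_eLpNorm_top_le_sqrt_log (hn : 2 ≤ n) {s : ℝ} (hs : 1 / 2 < s) :
    ∃ C : ℝ, 0 < C ∧
      ∀ u : Lp ℂ 2 (volume : Measure (EuclideanSpace ℝ (Fin n))),
        MemLp (besselFourier s u) 2 volume → IsRadial u →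
          eLpNorm (fun x ↦ ((‖x‖ ^ (((n : ℝ) - 1) / 2) : ℝ) : ℂ) * u x) ∞ volume ≤
            ENNReal.ofReal (C * sobolevNorm (1 / 2) u *
              √(Real.log (2 + sobolevNorm s u / sobolevNorm (1 / 2) u))) := by
  obtain ⟨K, hK, hstrauss⟩ := exists_norm_rpow_mul_norm_fourierInv_le hn
  -- The ratio combines `2^(k/2)` from Strauss with `2^(-sk)` from `H^s`; it is below `1` exactly
  -- because `s > 1 / 2`.
  obtain ⟨C, hC, hsum⟩ := exists_sum_range_le_mul_sqrt_log (D := 2 ^ s) (q := 2 ^ (1 / 2 - s))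
    (by positivity) (by positivity) (Real.rpow_lt_one_of_one_lt_of_neg one_lt_two (by linarith))
  refine ⟨K * √2 * C, by positivity, fun u hu hrad ↦ ?_⟩
  have hu' := memLp_besselFourier_mono hs.le hu
  rcases (ENNReal.toReal_nonneg : 0 ≤ sobolevNorm (1 / 2) u).eq_or_lt' with h0 | hpos
  · have hu0 := eq_zero_of_sobolevNorm_eq_zero hu' h0
    rw [eLpNorm_congr_ae (g := fun _ ↦ 0), eLpNorm_zero']
    · exact zero_le
    · filter_upwards [Lp.eq_zero_iff_ae_eq_zero.1 hu0] with x hx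
      rw [hx, Pi.zero_apply, mul_zero]
  refine eLpNorm_top_le_of_sum_le (by linarith) hu fun N x ↦ ?_
  have h1 := hsum (fun k ↦ √(2 ^ k) * (eLpNorm (shellPart u k) 2 volume).toReal) _ _
    (fun k ↦ by positivity) hpos (sobolevNorm_mono hs.le hu) (sum_sqrt_mul_shellPart_sq_le hu')
    (fun k ↦ ?_) N
  · calc _ ≤ ∑ k ∈ Finset.range N,
          K * √2 * (√(2 ^ k) * (eLpNorm (shellPart u k) 2 volume).toReal) := by
          refine Finset.sum_le_sum fun k _ ↦ ?_
          refine (hstrauss (M := 2 ^ (k + 1)) (by positivity) (memLp_shellPart u k)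
            (fun ξ hξ ↦ shellPart_eq_zero u hξ) (hrad.shellPart_comp_ae_eq k) x).trans_eq ?_
          rw [pow_succ', Real.sqrt_mul zero_le_two]
          ring
      _ ≤ K * √2 * (C * sobolevNorm (1 / 2) u *
            √(Real.log (2 + sobolevNorm s u / sobolevNorm (1 / 2) u))) := by
          rw [← Finset.mul_sum]
          gcongr
          exact h1
      _ = _ := by ring
  · have h2 := eLpNorm_indicator_fourier_le (by linarith) hu k
      (S := {ξ | shellIndex ξ = k}) fun ξ hξ ↦ hξ.ge
    have h3 : √((2 : ℝ) ^ k) * ((2 : ℝ) ^ (-s)) ^ k = ((2 : ℝ) ^ (1 / 2 - s)) ^ k := by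
      rw [Real.sqrt_eq_rpow, ← Real.rpow_natCast, ← Real.rpow_natCast, ← Real.rpow_natCast,
        ← Real.rpow_mul zero_le_two, ← Real.rpow_mul zero_le_two, ← Real.rpow_mul zero_le_two,
        ← Real.rpow_add two_pos]
      ring_nf
    calc √(2 ^ k) * (eLpNorm (shellPart u k) 2 volume).toReal
        ≤ √(2 ^ k) * (2 ^ s * ((2 : ℝ) ^ (-s)) ^ k * sobolevNorm s u) := by gcongr; exact h2
      _ = 2 ^ s * sobolevNorm s u * (√((2 : ℝ) ^ k) * ((2 : ℝ) ^ (-s)) ^ k) := by ring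
      _ = _ := by rw [h3]

end BrezisGallouetStrauss

/-- For `u = 0` the quotient is `0` by the convention for division, and the factor `sobolevNorm (1 /
2) u` makes the second bound `0`. -/
theorem proposition1 (n : ℕ) (hn : 2 ≤ n) (s : ℝ) (hs : 1 / 2 < s) :
    ∃ C : ℝ, 0 < C ∧
      ∀ u : Lp ℂ 2 (volume : Measure (EuclideanSpace ℝ (Fin n))),
        BrezisGallouetStrauss.MemSobolevRad s u →
          eLpNorm (fun x ↦ ((‖x‖ ^ (((n : ℝ) - 1) / 2) : ℝ) : ℂ) * u x) ∞ volume ≤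
            ENNReal.ofReal (C * BrezisGallouetStrauss.sobolevNorm s u) ∧
          eLpNorm (fun x ↦ ((‖x‖ ^ (((n : ℝ) - 1) / 2) : ℝ) : ℂ) * u x) ∞ volume ≤
            ENNReal.ofReal (C * BrezisGallouetStrauss.sobolevNorm (1 / 2) u *
              Real.sqrt (Real.log (2 + BrezisGallouetStrauss.sobolevNorm s u /
                BrezisGallouetStrauss.sobolevNorm (1 / 2) u))) := by
  open BrezisGallouetStrauss in
  obtain ⟨C, hC, h⟩ := exists_eLpNorm_top_le_sqrt_log hn hs
  refine ⟨2 * C, by positivity, fun u hu ↦ ?_⟩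
  have hmem := (memSobolev_iff_memLp_besselFourier (by linarith) u).1 hu.1
  have hlog := h u hmem hu.2
  have hA : 0 ≤ sobolevNorm (1 / 2) u := ENNReal.toReal_nonneg
  have hAB : sobolevNorm (1 / 2) u ≤ sobolevNorm s u := sobolevNorm_mono hs.le hmem
  refine ⟨hlog.trans (ENNReal.ofReal_le_ofReal ?_), hlog.trans (ENNReal.ofReal_le_ofReal ?_)⟩
  -- With `log (2 + t) ≤ 1 + t` and `A ≤ B`, `A² log (2 + B / A) ≤ A² + A B ≤ (2B)²`; hence the
  -- factor `2` in the constant.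
  · rw [mul_comm 2 C, mul_assoc, mul_assoc]
    refine mul_le_mul_of_nonneg_left ?_ hC.le
    set A := sobolevNorm (1 / 2) u
    set B := sobolevNorm s u
    have hB : 0 ≤ B := hA.trans hAB
    refine le_of_sq_le_sq ?_ (by positivity)
    have hlog0 : 0 ≤ Real.log (2 + B / A) :=
      Real.log_nonneg (by linarith [div_nonneg hB hA])
    have hlog1 : Real.log (2 + B / A) ≤ 1 + B / A := by
      have := Real.log_le_sub_one_of_pos (show 0 < 2 + B / A by positivity)
      linarith
    rw [mul_pow, Real.sq_sqrt hlog0]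
    calc A ^ 2 * Real.log (2 + B / A) ≤ A ^ 2 * (1 + B / A) := by gcongr
      _ = A ^ 2 + A * (A * (B / A)) := by ring
      _ ≤ A ^ 2 + A * B := by
        gcongr
        rcases hA.eq_or_lt with hA0 | hA0
        · rw [← hA0, zero_mul]
          exact hB
        · rw [mul_div_cancel₀ _ hA0.ne']
      _ ≤ (2 * B) ^ 2 := by nlinarith
  · rw [mul_assoc, mul_assoc, mul_assoc]
    exact le_mul_of_one_le_left (by positivity) one_le_two
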